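/- Let $G$ be a finite abelian group, written as an internal direct product $G=\mathbb{Z}_{m_1}\times\cdots\times\mathbb{Z}_{m_n}$ of cyclic groups of orders $m_1,\dots,m_n$ (for instance with $m_i\mid m_{i+1}$), and fix a generator $g_i$ of the $i$-th factor. **The normalized bar resolution.** $B_k$ is the free $\mathbb{Z}G$-module on the symbols $[h_1,\dots,h_k]$ with $h_i\in G\setminus\{1\}$; one puts $[h_1,\dots,h_k]=0$ if some $h_i=1$. For $k\ge 1$, $$\partial_k[h_1,\dots,h_k]=h_1[h_2,\dots,h_k]+\sum_{u=1}^{k-1}(-1)^u[h_1,\dots,h_uh_{u+1},\dots,h_k]+(-1)^k[h_1,\dots,h_{k-1}],$$ and $B_0=\mathbb{Z}G\to\mathbb{Z}$ sends $[\;]$ to $1$ ($\mathbb{Z}$ with trivial $G$-action). **The Koszul-like resolution.** $K_k$ is the free $\mathbb{Z}G$-module on generators $\Phi(a_1,\dots,a_n)$ with $a_i\ge 0$ and $a_1+\cdots+a_n=k$. Put $T_i=g_i-1$ and $N_i=\sum_{j=0}^{m_i-1}g_i^j$. The differential is $d=d_1+\cdots+d_n$, where $d_i\Phi(a_1,\dots,a_n)$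 is $0$ if $a_i=0$, is $(-1)^{\sum_{l<i}a_l}N_i\,\Phi(a_1,\dots,a_i-1,\dots,a_n)$ if $a_i\neq0$ is even, and is $(-1)^{\sum_{l<i}a_l}T_i\,\Phi(a_1,\dots,a_i-1,\dots,a_n)$ if $a_i$ is odd. The map $K_0=\mathbb{Z}G\to\mathbb{Z}$ sends $\Phi(0,\dots,0)$ to $1$. For $r_1<\cdots<r_l$ and $\lambda_1,\dots,\lambda_l\ge1$ let $\Phi_{r_1^{\lambda_1}\cdots r_l^{\lambda_l}}$ be the generator $\Phi(a_1,\dots,a_n)$ with $a_{r_u}=\lambda_u$ for $1\le u\le l$ and all other $a_i=0$. **The maps.** For $\alpha_i=(\alpha_{i1},\dots,\alpha_{in})$ with $0\le\alpha_{ij}<m_j$ write $g^{\alpha_i}=g_1^{\alpha_{i1}}\cdots g_n^{\alpha_{in}}$, and let $(g_r)_s=\sum_{j=0}^{s-1}g_r^j$. For $\alpha=(\alpha_1,\dots,\alpha_k)$, $1\le r\le n$ and $1\le a\le b\le k$ put $$\xi^\alpha_{r,[a,b]}=\begin{cases}\displaystyle\Big[\tfrac{\alpha_{br}+\alpha_{b-1,r}}{m_r}\Big]\Big[\tfrac{\alpha_{b-2,r}+\alpha_{b-3,r}}{m_r}\Big]\cdots\Big[\tfrac{\alpha_{a+1,r}+\alpha_{ar}}{m_r}\Big]\prod_{s<r}g_s^{\alpha_{as}+\cdots+\alpha_{bs}},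 & b-a\text{ odd},\\[2mm]\displaystyle\Big[\tfrac{\alpha_{br}+\alpha_{b-1,r}}{m_r}\Big]\Big[\tfrac{\alpha_{b-2,r}+\alpha_{b-3,r}}{m_r}\Big]\cdots\Big[\tfrac{\alpha_{a+2,r}+\alpha_{a+1,r}}{m_r}\Big]\prod_{s<r}g_s^{\alpha_{as}+\cdots+\alpha_{bs}}\,(g_r)_{\alpha_{ar}}, & b-a\text{ even},\end{cases}$$ where $[x]$ is the integer part of $x$ (and an empty product is $1$). Let $F_0$ be the identity of $\mathbb{Z}G$ (so $[\;]\mapsto\Phi(0,\dots,0)$), and for $k\ge1$ let $F_k\colon B_k\to K_k$ be the $\mathbb{Z}G$-linear map with $$F_k[g^{\alpha_1},\dots,g^{\alpha_k}]=\sum_{l=1}^{k}\ \sum_{\substack{1\le r_1<\cdots<r_l\le n\\ \lambda_1+\cdots+\lambda_l=k,\ \lambda_i\ge1}}(-1)^{\sum_{1\le i<j\le l}\lambda_i\lambda_j}\,\xi^\alpha_{r_1,[a_1,b_1]}\cdots\xi^\alpha_{r_l,[a_l,b_l]}\,\Phi_{r_1^{\lambda_1}\cdots r_l^{\lambda_l}},$$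 where $a_u=\sum_{i=u+1}^l\lambda_i+1$ and $b_u=\sum_{i=u}^l\lambda_i$. **Proposition.** The formula for $F_k$ is compatible with normalization: its right-hand side vanishes whenever some $g^{\alpha_i}=1$. The maps $F_k$ commute with the differentials, $F_{k}\,\partial_{k+1}=d\,F_{k+1}$ for all $k\ge0$, and $F_0$ commutes with the augmentations to $\mathbb{Z}$. So they form a chain map, over the identity of $\mathbb{Z}$, from the normalized bar resolution $(B_\bullet,\partial_\bullet)$ of $G$ to the Koszul-like resolution $(K_\bullet,d_\bullet)$. -/

import Mathlib

universe u

open CategoryTheory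

namespace BarKoszul

noncomputable section

/-! ### The integral group ring and its augmentation -/

/-- The integral group ring `ℤG`. -/
abbrev GroupRing (G : Type u) [CommGroup G] : Type u := MonoidAlgebra ℤ G

/-- A group element, viewed as an element of the group ring. -/
abbrev elt {G : Type u} [CommGroup G] (x : G) : GroupRing G := MonoidAlgebra.of ℤ G x

/-- The augmentation `ℤG → ℤ`, sending every group element to `1`. -/
def aug (G : Type u) [CommGroup G] : GroupRing G →+* ℤ :=
  (MonoidAlgebra.lift ℤ ℤ G (1 : G →* ℤ)).toRingHom

/-! ### The normalized bar resolution -/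

section Bar

variable (G : Type u) [CommGroup G]

/-- The `k`-th term `B_k` of the normalized bar resolution: the free `ℤG`-module on the symbols
`[h₁, …, h_k]` with all `h_i ∈ G` different from `1`. -/
abbrev Bar (k : ℕ) : Type u := (Fin k → {x : G // x ≠ 1}) →₀ GroupRing G

variable {G}

open scoped Classical in
/-- The symbol `[h₁, …, h_k]` for an arbitrary tuple in `G`; it is `0` in the normalized bar
resolution as soon as some `h_i` is `1`. -/
def sym {k : ℕ} (h : Fin k → G) : Bar G k :=
  if H : ∀ i, h i ≠ 1 then Finsupp.single (fun i => ⟨h i, H i⟩) 1 else 0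

/-- The boundary of the symbol `[h₁, …, h_{k+1}]`, namely
`h₁[h₂, …, h_{k+1}] + ∑_{u=1}^{k} (-1)^u [h₁, …, h_u h_{u+1}, …, h_{k+1}]
  + (-1)^{k+1} [h₁, …, h_k]`.
For `j < k` the tuple `Fin.contractNth j (· * ·) h` multiplies the two consecutive entries of `h` at
the (0-based) positions `j` and `j + 1`, and for `j = k` it drops the last entry. -/
def bdry {k : ℕ} (h : Fin (k + 1) → G) : Bar G k :=
  elt (h 0) • sym (Fin.tail h) +
    ∑ j : Fin (k + 1), ((-1 : ℤ) ^ ((j : ℕ) + 1)) • sym (Fin.contractNth j (· * ·) h)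

variable (G) in
/-- The differential `∂_{k+1} : B_{k+1} → B_k` of the normalized bar resolution. -/
def barD (k : ℕ) : Bar G (k + 1) →ₗ[GroupRing G] Bar G k :=
  Finsupp.linearCombination (GroupRing G) fun h => bdry fun i => (h i : G)

variable (G) in
/-- The augmentation `ε : B_0 → ℤ`, sending `[ ]` to `1`; it is linear for the trivial action of `G`
on `ℤ`, that is, semilinear along `ℤG → ℤ`. -/
def barEps : Bar G 0 →ₛₗ[aug G] ℤ where
  toFun x := aug G (x Fin.elim0)
  map_add' x y := by simp
  map_smul' c x := by simp

/-- The contracting homotopy of the normalized bar resolution, used here only to see that the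
differential squares to zero. -/
def barS (k : ℕ) : Bar G k →+ Bar G (k + 1) :=
  Finsupp.liftAddHom fun h =>
    (Finsupp.liftAddHom fun g : G => zmultiplesHom (Bar G (k + 1))
      (sym (Fin.cons g fun i => (h i : G)))).comp
    (MonoidAlgebra.coeffAddEquiv (R := ℤ) (M := G)).toAddMonoidHom

lemma sym_of_ne {k : ℕ} (h : Fin k → {x : G // x ≠ 1}) :
    sym (fun i => (h i : G)) = Finsupp.single h 1 := by
  unfold sym
  rw [dif_pos fun i => (h i).2]

lemma sym_eq_zero {k : ℕ} {h : Fin k → G} (i : Fin k) (hi : h i = 1) : sym h = 0 := by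
  unfold sym
  rw [dif_neg fun H => H i hi]

lemma barS_sym {k : ℕ} (g : G) (h : Fin k → G) :
    barS k (elt g • sym h) = sym (Fin.cons g h : Fin (k + 1) → G) := by
  by_cases H : ∀ i, h i ≠ 1
  · have : sym h = Finsupp.single (fun i => ⟨h i, H i⟩) 1 := by
      unfold sym; rw [dif_pos H]
    rw [this]
    simp [barS, elt, MonoidAlgebra.of]
  · push Not at H
    obtain ⟨i, hi⟩ := H
    rw [sym_eq_zero i hi, sym_eq_zero (h := (Fin.cons g h : Fin (k + 1) → G)) i.succ (by simpa)]
    simp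

lemma barD_sym {k : ℕ} (h : Fin (k + 1) → {x : G // x ≠ 1}) :
    barD G k (sym fun i => (h i : G)) = bdry fun i => (h i : G) := by
  rw [sym_of_ne]; simp [barD]

lemma bdry_cons {k : ℕ} (g : G) (h : Fin (k + 1) → G) :
    bdry (Fin.cons g h : Fin (k + 2) → G) = elt g • sym h - barS k (elt g • bdry h) := by
  have h0 : Fin.contractNth 0 (· * ·) (Fin.cons g h : Fin (k + 2) → G)
      = Fin.cons (g * h 0) (Fin.tail h) := by
    funext i
    refine Fin.cases ?_ (fun i => ?_) i
    · simp [Fin.contractNth]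
    · simp [Fin.contractNth, Fin.tail]
  have hs : ∀ j : Fin (k + 1), Fin.contractNth j.succ (· * ·) (Fin.cons g h : Fin (k + 2) → G)
      = Fin.cons g (Fin.contractNth j (· * ·) h) := by
    intro j
    funext i
    refine Fin.cases ?_ (fun i => ?_) i
    · simp [Fin.contractNth]
    · simp only [Fin.contractNth, Fin.cons_succ, Fin.val_succ, add_lt_add_iff_right,
        add_left_inj, ← Fin.succ_castSucc]
  have e : barS k (elt g • bdry h) = sym (Fin.cons (g * h 0) (Fin.tail h) : Fin (k + 1) → G)
      + ∑ j : Fin (k + 1), ((-1 : ℤ) ^ ((j : ℕ) + 1)) •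
        sym (Fin.cons g (Fin.contractNth j (· * ·) h) : Fin (k + 1) → G) := by
    unfold bdry
    rw [smul_add, map_add, smul_smul, ← map_mul, barS_sym, Finset.smul_sum, map_sum]
    congr 1
    refine Finset.sum_congr rfl fun j _ => ?_
    rw [smul_comm, map_zsmul, barS_sym]
  rw [e, bdry, Fin.sum_univ_succ, h0]
  simp only [hs, Fin.cons_zero, Fin.tail_cons, Fin.val_succ, Fin.val_zero]
  rw [sub_add_eq_sub_sub, sub_eq_add_neg _ (∑ j, _), ← Finset.sum_neg_distrib,
    sub_eq_add_neg, add_assoc]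
  congr 2
  · simp
  · refine Finset.sum_congr rfl fun j _ => ?_
    rw [pow_succ _ ((j : ℕ) + 1)]; simp

lemma barD_sym_cons {k : ℕ} (g : G) (h : Fin (k + 1) → {x : G // x ≠ 1}) :
    barD G (k + 1) (sym (Fin.cons g (fun i => (h i : G)) : Fin (k + 2) → G)) =
      elt g • sym (fun i => (h i : G)) - barS k (elt g • bdry fun i => (h i : G)) := by
  by_cases hg : g = 1
  · subst hg
    rw [sym_eq_zero (h := (Fin.cons 1 _ : Fin (k + 2) → G)) 0 (by simp), map_zero]
    have e : barS k (bdry fun i => (h i : G)) = sym (fun i => (h i : G)) := by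
      unfold bdry
      rw [map_add, barS_sym, map_sum, Finset.sum_eq_zero, add_zero]
      · congr 1
        funext i
        refine Fin.cases ?_ (fun i => ?_) i <;> simp [Fin.tail]
      · intro j _
        have := barS_sym (1 : G) (Fin.contractNth j (· * ·) fun i => (h i : G))
        rw [sym_eq_zero (h := (Fin.cons 1 _ : Fin (k + 1) → G)) 0 (by simp)] at this
        rw [map_zsmul]
        simp only [elt, map_one, one_smul] at this
        rw [this, smul_zero]
    simp only [elt, map_one, one_smul]
    rw [e, sub_self]
  · have : (Fin.cons g (fun i => (h i : G)) : Fin (k + 2) → G)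
        = fun i => ((Fin.cons ⟨g, hg⟩ h : Fin (k + 2) → {x : G // x ≠ 1}) i : G) := by
      funext i
      refine Fin.cases ?_ (fun i => ?_) i <;> simp
    rw [← bdry_cons, this, barD_sym]

lemma bar_addHom_ext {k : ℕ} {M : Type*} [AddCommGroup M] {f f' : Bar G k →+ M}
    (H : ∀ (g : G) (h : Fin k → {x : G // x ≠ 1}),
      f (elt g • sym fun i => (h i : G)) = f' (elt g • sym fun i => (h i : G))) : f = f' := by
  refine Finsupp.addHom_ext' fun h => ?_
  refine MonoidAlgebra.addMonoidHom_ext fun g z => ?_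
  have := H g h
  rw [sym_of_ne] at this
  simp only [elt, MonoidAlgebra.of_apply, Finsupp.smul_single, smul_eq_mul, mul_one] at this
  have e : MonoidAlgebra.single g z = z • (MonoidAlgebra.single g 1 : MonoidAlgebra ℤ G) := by
    simp
  simp only [AddMonoidHom.comp_apply, Finsupp.singleAddHom_apply]
  rw [e, ← Finsupp.smul_single, map_zsmul, map_zsmul, this]

lemma barD_barS {k : ℕ} (x : Bar G (k + 1)) :
    barD G (k + 1) (barS (k + 1) x) = x - barS k (barD G k x) := by
  have : ((barD G (k + 1)).toAddMonoidHom.comp (barS (k + 1)))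
      = AddMonoidHom.id _ - (barS k).comp (barD G k).toAddMonoidHom := by
    refine bar_addHom_ext fun g h => ?_
    simp only [AddMonoidHom.comp_apply, LinearMap.toAddMonoidHom_coe, AddMonoidHom.sub_apply,
      AddMonoidHom.id_apply]
    rw [barS_sym, barD_sym_cons, (barD G k).map_smul, barD_sym]
  exact DFunLike.congr_fun this x

/-- The differential of the normalized bar resolution squares to zero. -/
lemma barD_comp_barD (k : ℕ) : barD G k ∘ₗ barD G (k + 1) = 0 := by
  induction k with
  | zero =>
    refine Finsupp.lhom_ext' fun h => LinearMap.ext_ring ?_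
    simp only [LinearMap.comp_apply, Finsupp.lsingle_apply, ← sym_of_ne, LinearMap.zero_apply]
    have b1 : ∀ x : Fin 1 → G, bdry x = elt (x 0) • sym Fin.elim0 - sym Fin.elim0 := by
      intro x
      unfold bdry
      rw [Subsingleton.elim (Fin.tail x) Fin.elim0]
      rw [Fin.sum_univ_one, Subsingleton.elim (Fin.contractNth 0 (· * ·) x) Fin.elim0]
      simp [sub_eq_add_neg]
    have b2 : ∀ x : G, barD G 0 (sym fun _ : Fin 1 => x)
        = elt x • sym Fin.elim0 - sym Fin.elim0 := by
      intro x
      by_cases hx : x = 1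
      · subst hx; rw [sym_eq_zero 0 rfl]; simp only [elt, map_one, one_smul, sub_self, map_zero]
      · exact (barD_sym fun _ : Fin 1 => (⟨x, hx⟩ : {x : G // x ≠ 1})).trans (b1 _)
    have b3 : ∀ x : Fin 1 → G, barD G 0 (sym x) = elt (x 0) • sym Fin.elim0 - sym Fin.elim0 := by
      intro x
      rw [← b2]
      congr 2
      funext i
      rw [Subsingleton.elim i 0]
    rw [barD_sym, bdry, map_add, map_smul, map_sum, Fin.sum_univ_two, map_zsmul, map_zsmul,
      b3, b3, b3, smul_sub, smul_smul, ← map_mul]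
    have e0 : Fin.tail (fun i => (h i : G)) 0 = h 1 := rfl
    have e1 : Fin.contractNth (0 : Fin 2) (· * ·) (fun i => (h i : G)) 0 = h 0 * h 1 := rfl
    have e2 : Fin.contractNth (1 : Fin 2) (· * ·) (fun i => (h i : G)) 0 = h 0 := rfl
    rw [e0, e1, e2]
    simp
  | succ k ih =>
    have ih' : ∀ x, barD G k (barD G (k + 1) x) = 0 := fun x => LinearMap.congr_fun ih x
    refine Finsupp.lhom_ext' fun h => LinearMap.ext_ring ?_
    have hh : (fun i => (h i : G)) =
        (Fin.cons (h 0 : G) (fun i => (Fin.tail h i : G)) : Fin (k + 3) → G) := by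
      funext i; refine Fin.cases ?_ (fun i => ?_) i <;> simp [Fin.tail]
    simp only [LinearMap.comp_apply, Finsupp.lsingle_apply, ← sym_of_ne, LinearMap.zero_apply]
    rw [hh, ← barS_sym, barD_barS, map_sub, barD_barS, ih', map_zero, sub_zero, sub_self]

variable (G) in
/-- The normalized bar resolution `(B_•, ∂_•)` of `G`, as a chain complex of `ℤG`-modules. -/
def barComplex : ChainComplex (ModuleCat.{u} (GroupRing G)) ℕ :=
  ChainComplex.of (fun k => ModuleCat.of (GroupRing G) (Bar G k))
    (fun k => ModuleCat.ofHom (barD G k))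
    (fun k => by rw [← ModuleCat.ofHom_comp, barD_comp_barD]; rfl)

end Bar

/-! ### Finite abelian groups with chosen generators of their cyclic factors -/

/-- A decomposition `G = ℤ_{m₁} × ⋯ × ℤ_{m_n}` of a finite abelian group as an internal direct
product of cyclic groups, with a fixed generator `g_i` of order `m_i` of the `i`-th factor: every
element of `G` is `g₁^{e₁} ⋯ g_n^{e_n}` for exactly one tuple of exponents `0 ≤ e_i < m_i`. -/
structure CyclicFactors (G : Type u) [CommGroup G] {n : ℕ} (m : Fin n → ℕ) where
  /-- The generators of the cyclic factors. -/
  g : Fin n → G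
  orderOf_g : ∀ i, orderOf (g i) = m i
  bijective : Function.Bijective fun e : (i : Fin n) → Fin (m i) => ∏ i, g i ^ (e i : ℕ)

namespace CyclicFactors

variable {G : Type u} [CommGroup G] {n : ℕ} {m : Fin n → ℕ} (D : CyclicFactors G m)

/-- The exponents of a group element: `x = g₁^{exponent x 1} ⋯ g_n^{exponent x n}` with
`0 ≤ exponent x i < m_i`. -/
def exponent (x : G) (i : Fin n) : ℕ := ((Equiv.ofBijective _ D.bijective).symm x i : ℕ)

/-- `(g_i)_r = 1 + g_i + ⋯ + g_i^{r-1}`. -/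
def geom (i : Fin n) (r : ℕ) : GroupRing G := ∑ j ∈ Finset.range r, elt (D.g i ^ j)

/-- `T_i = g_i - 1`. -/
def T (i : Fin n) : GroupRing G := elt (D.g i) - 1

/-- `N_i = 1 + g_i + ⋯ + g_i^{m_i - 1}`. -/
def N (i : Fin n) : GroupRing G := ∑ j ∈ Finset.range (m i), elt (D.g i ^ j)

/-! ### The Koszul-like resolution -/

/-- The `k`-th term `K_k` of the Koszul-like resolution: the free `ℤG`-module on the generators
`Φ(a₁, …, a_n)`, where `a₁, …, a_n` are nonnegative integers with `a₁ + ⋯ + a_n = k`. -/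
abbrev Koszul (_D : CyclicFactors G m) (k : ℕ) : Type u :=
  {a : Fin n → ℕ // ∑ i, a i = k} →₀ GroupRing G

/-- The generator `Φ(a₁, …, a_n)` of `K_k`, for `a₁ + ⋯ + a_n = k`. (It is only used for such `a`;
for convenience it is set to `0` in a wrong degree `k`.) -/
def Phi (k : ℕ) (a : Fin n → ℕ) : D.Koszul k :=
  if H : ∑ i, a i = k then Finsupp.single ⟨a, H⟩ 1 else 0

/-- The `i`-th part `d_i` of the differential on `Φ(a)`: it is `0` if `a_i = 0`, and otherwise it is
`(-1)^{∑_{l<i} a_l} N_i Φ(a₁, …, a_i - 1, …, a_n)` for `a_i` even and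
`(-1)^{∑_{l<i} a_l} T_i Φ(a₁, …, a_i - 1, …, a_n)` for `a_i` odd. -/
def koszulPart (k : ℕ) (i : Fin n) (a : Fin n → ℕ) : D.Koszul k :=
  if a i = 0 then 0
  else ((-1 : ℤ) ^ (∑ l ∈ Finset.Iio i, a l)) •
    (if Even (a i) then D.N i else D.T i) • D.Phi k (Function.update a i (a i - 1))

/-- The differential `d = d₁ + ⋯ + d_n : K_{k+1} → K_k`. -/
def koszulD (k : ℕ) : D.Koszul (k + 1) →ₗ[GroupRing G] D.Koszul k :=
  Finsupp.linearCombination (GroupRing G) fun a => ∑ i, D.koszulPart k i a.1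

/-- The augmentation `K_0 → ℤ`, sending `Φ(0, …, 0)` to `1`; it is linear for the trivial action of
`G` on `ℤ`, that is, semilinear along `ℤG → ℤ`. -/
def koszulEps : D.Koszul 0 →ₛₗ[aug G] ℤ where
  toFun x := aug G (x ⟨fun _ => 0, by simp⟩)
  map_add' x y := by simp
  map_smul' c x := by simp

lemma sum_update_pred (a : Fin n → ℕ) (i : Fin n) (hi : a i ≠ 0) :
    ∑ l, Function.update a i (a i - 1) l + 1 = ∑ l, a l := by
  rw [Finset.sum_update_of_mem (Finset.mem_univ i),
    ← Finset.add_sum_erase _ a (Finset.mem_univ i), Finset.sdiff_singleton_eq_erase]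
  omega

lemma Phi_of_sum {k : ℕ} (a : {a : Fin n → ℕ // ∑ i, a i = k}) :
    D.Phi k a.1 = Finsupp.single a 1 := by
  unfold Phi
  rw [dif_pos a.2]

lemma koszulD_Phi {k : ℕ} (a : Fin n → ℕ) :
    D.koszulD k (D.Phi (k + 1) a) = ∑ i, D.koszulPart k i a := by
  by_cases H : ∑ i, a i = k + 1
  · have := D.Phi_of_sum (k := k + 1) ⟨a, H⟩
    simp only at this
    rw [this]; simp [koszulD]
  · have h0 : D.Phi (k + 1) a = 0 := by unfold Phi; rw [dif_neg H]
    rw [h0, map_zero, eq_comm]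
    refine Finset.sum_eq_zero fun i _ => ?_
    unfold koszulPart
    split_ifs with h1 h2
    · rfl
    all_goals
      have := sum_update_pred a i h1
      rw [Phi, dif_neg (by omega)]; simp

lemma T_mul_N (i : Fin n) : D.T i * D.N i = 0 := by
  have h1 : D.N i = ∑ j ∈ Finset.range (m i), elt (D.g i) ^ j := by simp [N, elt]
  rw [T, h1, mul_geom_sum, ← D.orderOf_g i, ← map_pow, pow_orderOf_eq_one, map_one, sub_self]

lemma parity_mul (i : Fin n) (c : ℕ) (hc : c ≠ 0) :
    (if Even c then D.N i else D.T i) * (if Even (c - 1) then D.N i else D.T i) = 0 := by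
  by_cases he : Even c
  · rw [if_pos he, if_neg (by rw [Nat.even_sub (by omega)]; simp [he]), mul_comm, T_mul_N]
  · rw [if_neg he, if_pos (by rw [Nat.even_sub (by omega)]; simp [he]), T_mul_N]

/-- The differential of the Koszul-like resolution squares to zero. -/
lemma koszulD_comp_koszulD (k : ℕ) : D.koszulD k ∘ₗ D.koszulD (k + 1) = 0 := by
  refine Finsupp.lhom_ext' fun a => LinearMap.ext_ring ?_
  simp only [LinearMap.comp_apply, Finsupp.lsingle_apply, ← D.Phi_of_sum, LinearMap.zero_apply]
  obtain ⟨a, -⟩ := a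
  have hpart : ∀ i, D.koszulD k (D.koszulPart (k + 1) i a) =
      ∑ j, if a i = 0 then 0 else ((-1 : ℤ) ^ (∑ l ∈ Finset.Iio i, a l)) •
        (if Even (a i) then D.N i else D.T i) •
          D.koszulPart k j (Function.update a i (a i - 1)) := by
    intro i
    by_cases h : a i = 0
    · simp [koszulPart, h]
    · rw [koszulPart, if_neg h, map_zsmul, map_smul, koszulD_Phi, Finset.smul_sum,
        Finset.smul_sum]
      simp [h]
  rw [koszulD_Phi, map_sum]
  simp only [hpart]
  rw [← Finset.sum_product']
  have diag : ∀ i : Fin n, (if a i = 0 then 0 else ((-1 : ℤ) ^ (∑ l ∈ Finset.Iio i, a l)) •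
      (if Even (a i) then D.N i else D.T i) •
        D.koszulPart k i (Function.update a i (a i - 1))) = 0 := by
    intro i
    by_cases hi : a i = 0
    · simp [hi]
    by_cases hi' : a i - 1 = 0
    · simp [koszulPart, hi']
    simp only [hi, if_false, koszulPart, Function.update_self, hi']
    rw [smul_comm (if Even (a i) then D.N i else D.T i), smul_smul (_ : GroupRing G),
      D.parity_mul i _ hi, zero_smul, smul_zero, smul_zero]
  refine Finset.sum_ninvolution (fun p => (p.2, p.1)) ?_ ?_ (by simp) (by simp)
  · have main : ∀ i j : Fin n, i < j →
        ((if a i = 0 then 0 else ((-1 : ℤ) ^ (∑ l ∈ Finset.Iio i, a l)) •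
          (if Even (a i) then D.N i else D.T i) •
            D.koszulPart k j (Function.update a i (a i - 1))) +
        (if a j = 0 then 0 else ((-1 : ℤ) ^ (∑ l ∈ Finset.Iio j, a l)) •
          (if Even (a j) then D.N j else D.T j) •
            D.koszulPart k i (Function.update a j (a j - 1)))) = 0 := by
      intro i j hij
      have hne : i ≠ j := hij.ne
      by_cases hi : a i = 0
      · simp [hi, koszulPart, hne]
      by_cases hj : a j = 0
      · simp [hj, koszulPart, hne.symm]
      have s1 : ∑ l ∈ Finset.Iio i, Function.update a j (a j - 1) l = ∑ l ∈ Finset.Iio i, a l := by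
        refine Finset.sum_congr rfl fun l hl => ?_
        rw [Function.update_of_ne]
        rintro rfl
        exact absurd (Finset.mem_Iio.1 hl) (not_lt.2 hij.le)
      have s2 : ∑ l ∈ Finset.Iio j, Function.update a i (a i - 1) l + 1
          = ∑ l ∈ Finset.Iio j, a l := by
        have hmem : i ∈ Finset.Iio j := Finset.mem_Iio.2 hij
        rw [Finset.sum_update_of_mem hmem, ← Finset.add_sum_erase _ a hmem,
          Finset.sdiff_singleton_eq_erase]
        omega
      simp only [hi, hj, if_false, koszulPart, Function.update_of_ne hne,
        Function.update_of_ne hne.symm]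
      rw [s1, ← s2, Function.update_comm hne, pow_succ]
      generalize (if Even (a i) then D.N i else D.T i) = x
      generalize (if Even (a j) then D.N j else D.T j) = y
      rw [smul_comm x, smul_comm y, smul_smul, smul_smul, smul_smul, smul_smul, mul_comm y x,
        ← add_smul]
      convert zero_smul ℤ _
      ring
    rintro ⟨i, j⟩
    rcases lt_trichotomy i j with h | h | h
    · exact main i j h
    · subst h
      simp only [diag, add_zero]
    · rw [add_comm]; exact main j i h
  · rintro ⟨i, j⟩ hf heq
    simp only [Prod.mk.injEq] at heq
    obtain ⟨rfl, -⟩ := heq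
    exact hf (diag j)

/-- The Koszul-like resolution `(K_•, d_•)`, as a chain complex of `ℤG`-modules. -/
def koszulComplex : ChainComplex (ModuleCat.{u} (GroupRing G)) ℕ :=
  ChainComplex.of (fun k => ModuleCat.of (GroupRing G) (D.Koszul k))
    (fun k => ModuleCat.ofHom (D.koszulD k))
    (fun k => by rw [← ModuleCat.ofHom_comp, koszulD_comp_koszulD]; rfl)

/-! ### The maps `F_k` -/

/-- The exponent `α_{ir}` of `g_r` in the `i`-th entry of a tuple `(h₁, …, h_k)`. Here `i` is counted
from `1`, so that `α_{ir}` is meaningful for `1 ≤ i ≤ k`. -/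
def alpha {k : ℕ} (h : Fin k → G) (i : ℕ) (r : Fin n) : ℕ :=
  if H : 1 ≤ i ∧ i ≤ k then D.exponent (h ⟨i - 1, by omega⟩) r else 0

/-- The element `ξ^α_{r,[a,b]}` of `ℤG` for `a ≤ b`. With
`M = ∏_{s<r} g_s^{α_{as} + ⋯ + α_{bs}}` it is
`[(α_{br}+α_{b-1,r})/m_r] [(α_{b-2,r}+α_{b-3,r})/m_r] ⋯ [(α_{a+1,r}+α_{ar})/m_r] M` if `b - a` is
odd, and
`[(α_{br}+α_{b-1,r})/m_r] [(α_{b-2,r}+α_{b-3,r})/m_r] ⋯ [(α_{a+2,r}+α_{a+1,r})/m_r] M (g_r)_{α_{ar}}`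
if `b - a` is even. The quotients are integer parts. -/
def xi (α : ℕ → Fin n → ℕ) (r : Fin n) (a b : ℕ) : GroupRing G :=
  if Odd (b - a) then
    (∏ j ∈ Finset.range ((b - a + 1) / 2),
        (((α (b - 2 * j) r + α (b - 2 * j - 1) r) / m r : ℕ) : GroupRing G)) *
      elt (∏ s ∈ Finset.Iio r, D.g s ^ (∑ c ∈ Finset.Icc a b, α c s))
  else
    (∏ j ∈ Finset.range ((b - a) / 2),
        (((α (b - 2 * j) r + α (b - 2 * j - 1) r) / m r : ℕ) : GroupRing G)) *
      elt (∏ s ∈ Finset.Iio r, D.g s ^ (∑ c ∈ Finset.Icc a b, α c s)) *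
      D.geom r (α a r)

/-- The sign `(-1)^{∑_{i<j} λ_i λ_j}` of a composition `λ₁ + ⋯ + λ_l = k`. -/
def compSign {k : ℕ} (c : Composition k) : ℤ :=
  (-1) ^ (∑ i, ∑ j ∈ Finset.Ioi i, c.blocksFun i * c.blocksFun j)

/-- The left end `a_u = ∑_{i>u} λ_i + 1` of the `u`-th interval of a composition. -/
def lower {k : ℕ} (c : Composition k) (u : Fin c.length) : ℕ :=
  (∑ i ∈ Finset.Ioi u, c.blocksFun i) + 1

/-- The right end `b_u = ∑_{i≥u} λ_i` of the `u`-th interval of a composition. -/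
def upper {k : ℕ} (c : Composition k) (u : Fin c.length) : ℕ :=
  ∑ i ∈ Finset.Ici u, c.blocksFun i

/-- The exponent vector of `Φ_{r₁^{λ₁} ⋯ r_l^{λ_l}}`: it has the entry `λ_u` in position `r_u`, for
`1 ≤ u ≤ l`, and is zero elsewhere. -/
def expVec {k : ℕ} (c : Composition k) (r : Fin c.length ↪o Fin n) : Fin n → ℕ :=
  ∑ u, Pi.single (r u) (c.blocksFun u)

/-- `Φ_{r₁^{λ₁} ⋯ r_l^{λ_l}}` is a generator of degree `λ₁ + ⋯ + λ_l = k`. -/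
lemma sum_expVec {k : ℕ} (c : Composition k) (r : Fin c.length ↪o Fin n) :
    ∑ s, expVec c r s = k := by
  simp only [expVec, Finset.sum_apply]
  rw [Finset.sum_comm]
  simp [c.sum_blocksFun]

open scoped Classical in
/-- The value prescribed for `F_k` on the symbol `[h₁, …, h_k]`, where `h_i = g^{α_i}`:
`∑ (-1)^{∑_{i<j} λ_i λ_j} ξ^α_{r₁,[a₁,b₁]} ⋯ ξ^α_{r_l,[a_l,b_l]} Φ_{r₁^{λ₁} ⋯ r_l^{λ_l}}`,
the sum over all compositions `λ₁ + ⋯ + λ_l = k` with `λ_i ≥ 1` and all `r₁ < ⋯ < r_l`.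
For `k = 0` there is only the empty composition, and the value on `[ ]` is `Φ(0, …, 0)`. -/
def FValue {k : ℕ} (h : Fin k → G) : D.Koszul k :=
  ∑ c : Composition k, ∑ r : Fin c.length ↪o Fin n,
    compSign c • (∏ u, D.xi (D.alpha h) (r u) (lower c u) (upper c u)) • D.Phi k (expVec c r)

/-- The `ℤG`-linear map `F_k : B_k → K_k`. -/
def F (k : ℕ) : Bar G k →ₗ[GroupRing G] D.Koszul k :=
  Finsupp.linearCombination (GroupRing G) fun h => D.FValue fun i => (h i : G)

end CyclicFactors

end

end BarKoszul

/-! ### Contraction of sequences -/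

namespace BarKoszul

/-! A composition of `k` together with an increasing choice of indices is the same as an exponent
vector `a` with sum `k`: the indices are its support, the blocks its nonzero entries. So `F_k` is a
sum over vectors `a` (`FValue_eq`). Up to sign, the coefficient of `Φ(a)` is a product over the
cyclic factors `r` of terms reading consecutive segments of length `a r`, the segment of the last
factor standing first.

For a single factor the term is the classical comparison for a cyclic group: a geometric sum in
degree one, and one more carry for every two degrees. It satisfies a coboundary formula
(`step_mul_cochain`) because carries form a 2-cocycle and because geometric sums fail to be additive
exactly by a carry times `N`. Twisting by the projection `M_r` onto the first `r` factors
(`prefixHom`, with `r` counted from `0`) makes the left end act through `M_{r+1}` and the right end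
through `M_r` (`step_mul_twisted`).

In the product, the right end of each segment therefore cancels the left end of the next. What
survives is `M_n = id` on the far left, `M_0 = 1` on the far right, and the contractions inside
segments: this is the bar boundary (`segmentProd_coboundary`). The resulting signs involve the
indices above `i`, those of the Koszul differential the indices below; the quadratic sign in `F_k`
converts one into the other (`vecSign_update`). -/

/-- The sequence obtained from `w` by multiplying the entries at the positions `u` and `u + 1`. -/
def contractSeq {G : Type*} [Mul G] (u : ℕ) (w : ℕ → G) (i : ℕ) : G :=
  if i < u then w i else if i = u then w u * w (u + 1) else w (i + 1)

lemma contractSeq_of_lt {G : Type*} [Mul G] {u i : ℕ} (w : ℕ → G) (h : i < u) :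
    contractSeq u w i = w i := if_pos h

lemma contractSeq_self {G : Type*} [Mul G] (u : ℕ) (w : ℕ → G) :
    contractSeq u w u = w u * w (u + 1) := by simp [contractSeq]

lemma contractSeq_of_gt {G : Type*} [Mul G] {u i : ℕ} (w : ℕ → G) (h : u < i) :
    contractSeq u w i = w (i + 1) := by
  rw [contractSeq, if_neg (by omega), if_neg (by omega)]

lemma contractSeq_add {G : Type*} [Mul G] (u p : ℕ) (w : ℕ → G) :
    (fun i => contractSeq (p + u) w (i + p)) = contractSeq u fun i => w (i + p) := by
  funext i
  rcases lt_trichotomy i u with h | rfl | h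
  · rw [contractSeq_of_lt _ h, contractSeq_of_lt _ (by omega)]
  · rw [contractSeq_self, add_comm p i, contractSeq_self, add_right_comm]
  · rw [contractSeq_of_gt _ h, contractSeq_of_gt _ (by omega), add_right_comm]

/-! ### Coboundary of a product over consecutive segments -/

section Telescope

variable {R G : Type*} [CommRing R]

/-- The product of the values of `y r` on consecutive segments of `w`, of lengths `a r`; the
segment of the last index comes first. -/
def segmentProd {n : ℕ} (y : Fin n → ℕ → (ℕ → G) → R) (a : Fin n → ℕ) (w : ℕ → G) : R :=
  ∏ r, y r (a r) fun i => w (i + ∑ s ∈ Finset.Ioi r, a s)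

lemma sum_Ioi_castSucc {n : ℕ} (a : Fin (n + 1) → ℕ) (r : Fin n) :
    ∑ s ∈ Finset.Ioi r.castSucc, a s
      = ∑ s ∈ Finset.Ioi r, a s.castSucc + a (Fin.last n) := by
  have h : ∀ (k : ℕ) (r : Fin k), Finset.Ioi r = Finset.univ.filter (r < ·) := by
    intros; ext; simp
  rw [h, h, Finset.sum_filter, Finset.sum_filter, Fin.sum_univ_castSucc]
  simp [Fin.castSucc_lt_last]

/-- Peels off the front segment, which belongs to the last index; this drives every induction on the
number of factors. -/
lemma segmentProd_succ {n : ℕ} (y : Fin (n + 1) → ℕ → (ℕ → G) → R) (a : Fin (n + 1) → ℕ)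
    (w : ℕ → G) :
    segmentProd y a w = y (Fin.last n) (a (Fin.last n)) w *
      segmentProd (fun r => y r.castSucc) (fun r => a r.castSucc)
        fun i => w (i + a (Fin.last n)) := by
  have h : Finset.Ioi (Fin.last n) = ∅ := by ext; simp [Fin.le_last]
  simp only [segmentProd, Fin.prod_univ_castSucc, sum_Ioi_castSucc, h, Finset.sum_empty, add_zero,
    add_assoc]
  rw [mul_comm]

lemma segmentProd_congr {n : ℕ} {y : Fin n → ℕ → (ℕ → G) → R}
    (hloc : ∀ r p w w', (∀ i < p, w i = w' i) → y r p w = y r p w')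
    (a : Fin n → ℕ) {w w' : ℕ → G} (h : ∀ i < ∑ s, a s, w i = w' i) :
    segmentProd y a w = segmentProd y a w' := by
  induction n generalizing w w' with
  | zero => simp [segmentProd]
  | succ n ih =>
    rw [Fin.sum_univ_castSucc] at h
    rw [segmentProd_succ, segmentProd_succ, hloc _ _ w w' fun i hi => h i (by omega)]
    congr 1
    exact ih (fun r => hloc r.castSucc) _ fun i hi => h _ (by omega)

lemma segmentProd_eq_zero {n : ℕ} {y : Fin n → ℕ → (ℕ → G) → R} {x : G}
    (hz : ∀ r p w i, i < p → w i = x → y r p w = 0)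
    (a : Fin n → ℕ) {w : ℕ → G} {i : ℕ} (hi : i < ∑ s, a s) (hx : w i = x) :
    segmentProd y a w = 0 := by
  induction n generalizing w i with
  | zero => simp at hi
  | succ n ih =>
    rw [Fin.sum_univ_castSucc] at hi
    rw [segmentProd_succ]
    by_cases h : i < a (Fin.last n)
    · rw [hz _ _ w i h hx, zero_mul]
    · rw [ih (fun r => hz r.castSucc) _ (i := i - a (Fin.last n)) (by omega)
        (by rwa [Nat.sub_add_cancel (by omega)]), mul_zero]

/-- Twisted coboundary formulas for the factors `y r` combine to one for the product over
consecutive segments. -/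
theorem segmentProd_coboundary [Mul G] {n : ℕ} (M : ℕ → G → R) (y : Fin n → ℕ → (ℕ → G) → R)
    (D : Fin n → ℕ → R) (hM : ∀ x, M 0 x = 1)
    (hloc : ∀ r p w w', (∀ i < p, w i = w' i) → y r p w = y r p w')
    (hy : ∀ r p w, D r p * y r (p + 1) w = M (r + 1) (w 0) * y r p (fun i => w (i + 1)) +
      ∑ u ∈ Finset.range p, (-1) ^ (u + 1) * y r p (contractSeq u w) +
      (-1) ^ (p + 1) * (y r p w * M r (w p)))
    (a : Fin n → ℕ) (w : ℕ → G) :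
    ∑ i, (-1) ^ (∑ s ∈ Finset.Ioi i, a s) * (D i (a i) *
        segmentProd y (Function.update a i (a i + 1)) w) =
      M n (w 0) * segmentProd y a (fun i => w (i + 1)) +
      ∑ u ∈ Finset.range (∑ i, a i), (-1) ^ (u + 1) * segmentProd y a (contractSeq u w) +
      (-1) ^ (∑ i, a i + 1) * segmentProd y a w := by
  induction n generalizing w with
  | zero => simp [segmentProd, hM]
  | succ n ih =>
    -- The remaining factors see the sequence only after the front segment.
    have ih := ih (fun r => y r.castSucc) (fun r => D r.castSucc)
      (fun r => hloc r.castSucc) (fun r => hy r.castSucc) (fun r => a r.castSucc)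
      (fun i => w (i + a (Fin.last n)))
    have hlast := hy (Fin.last n) (a (Fin.last n)) w
    have hIoi : Finset.Ioi (Fin.last n) = ∅ := by ext; simp [Fin.le_last]
    have hup : ∀ i : Fin n, (fun r : Fin n =>
        Function.update a i.castSucc (a i.castSucc + 1) r.castSucc) =
        Function.update (fun r => a r.castSucc) i (a i.castSucc + 1) := by
      intro i; funext r
      by_cases h : r = i
      · subst h; simp
      · rw [Function.update_of_ne h, Function.update_of_ne (by simpa using h)]
    have hupl : (fun r : Fin n => Function.update a (Fin.last n) (a (Fin.last n) + 1) r.castSucc)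
        = fun r => a r.castSucc := by
      funext r; rw [Function.update_of_ne (Fin.castSucc_lt_last r).ne]
    have hupl' : ∀ i : Fin n, Function.update a i.castSucc (a i.castSucc + 1) (Fin.last n)
        = a (Fin.last n) := fun i => by rw [Function.update_of_ne (Fin.castSucc_lt_last i).ne']
    rw [Fin.sum_univ_castSucc]
    simp only [segmentProd_succ, sum_Ioi_castSucc, hIoi, Finset.sum_empty, pow_zero, one_mul, hup,
      hupl, hupl', Function.update_self, Fin.sum_univ_castSucc]
    set p := a (Fin.last n) with hp
    set b : Fin n → ℕ := fun r => a r.castSucc with hb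
    set C := segmentProd (fun r => y r.castSucc) b with hC
    have e1 : ∀ i : Fin n, (-1 : R) ^ (∑ s ∈ Finset.Ioi i, a s.castSucc + p) *
        (D i.castSucc (a i.castSucc) * (y (Fin.last n) p w *
          segmentProd (fun r => y r.castSucc) (Function.update b i (a i.castSucc + 1))
            fun i => w (i + p))) =
        (-1) ^ p * y (Fin.last n) p w * ((-1) ^ (∑ s ∈ Finset.Ioi i, a s.castSucc) *
          (D i.castSucc (a i.castSucc) *
          segmentProd (fun r => y r.castSucc) (Function.update b i (a i.castSucc + 1))
            fun i => w (i + p))) := fun i => by ring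
    rw [Finset.sum_congr rfl fun i _ => e1 i, ← Finset.mul_sum, ih, ← mul_assoc, hlast,
      show ∑ i : Fin n, a i.castSucc = ∑ i, b i from rfl, add_comm (∑ i, b i) p,
      Finset.sum_range_add]
    -- Contracting inside the front segment consumes one extra entry, so the remaining factors start
    -- at `p + 1`.
    have e2 : ∀ u ∈ Finset.range p, (-1 : R) ^ (u + 1) *
        (y (Fin.last n) p (contractSeq u w) * C fun i => contractSeq u w (i + p)) =
        (-1 : R) ^ (u + 1) * y (Fin.last n) p (contractSeq u w) *
          C fun i => w (i + (p + 1)) := by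
      intro u hu
      have : (fun i => contractSeq u w (i + p)) = fun i => w (i + (p + 1)) := by
        funext i
        rw [contractSeq_of_gt _ (by have := Finset.mem_range.1 hu; omega), add_assoc]
      rw [this, mul_assoc]
    -- Contracting at `p + u` leaves the front segment untouched and contracts the rest at `u`.
    have e3 : ∀ u ∈ Finset.range (∑ i, b i), (-1 : R) ^ (p + u + 1) *
        (y (Fin.last n) p (contractSeq (p + u) w) * C fun i => contractSeq (p + u) w (i + p)) =
        (-1) ^ p * y (Fin.last n) p w *
          ((-1) ^ (u + 1) * C (contractSeq u fun i => w (i + p))) := by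
      intro u _
      rw [contractSeq_add, hloc (Fin.last n) p (contractSeq (p + u) w) w
        fun i hi => contractSeq_of_lt _ (by omega)]
      ring
    -- What remains is the junction: the right end of the front segment and the left end of the rest
    -- both carry `M n (w p)`, with signs `(-1)^(p+1)` and `(-1)^p`, and cancel.
    rw [Finset.sum_congr rfl e2, Finset.sum_congr rfl e3, ← Finset.sum_mul, ← Finset.mul_sum]
    simp only [Fin.val_last, zero_add, add_assoc, add_comm 1 p]
    ring

end Telescope
end BarKoszul

namespace BarKoszul.CyclicFactors

/-! ### Exponents, geometric sums and carries -/

noncomputable section Cochains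

variable {G : Type u} [CommGroup G] {n : ℕ} {m : Fin n → ℕ} (D : CyclicFactors G m)

lemma elt_mul (x y : G) : elt (x * y) = elt x * elt y := map_mul _ x y

lemma elt_one : elt (1 : G) = 1 := map_one _

lemma elt_pow (x : G) (e : ℕ) : elt (x ^ e) = elt x ^ e := map_pow _ x e

lemma prod_exponent (x : G) : ∏ i, D.g i ^ D.exponent x i = x :=
  (Equiv.ofBijective _ D.bijective).apply_symm_apply x

lemma exponent_lt (x : G) (i : Fin n) : D.exponent x i < m i :=
  ((Equiv.ofBijective _ D.bijective).symm x i).2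

lemma exponent_eq {x : G} {e : Fin n → ℕ} (he : ∀ i, e i < m i) (hx : ∏ i, D.g i ^ e i = x) :
    D.exponent x = e := by
  have : (Equiv.ofBijective _ D.bijective).symm x = fun i => ⟨e i, he i⟩ :=
    (Equiv.symm_apply_eq _).2 hx.symm
  funext i
  rw [exponent, this]

lemma g_pow_m (i : Fin n) : D.g i ^ m i = 1 := by rw [← D.orderOf_g i, pow_orderOf_eq_one]

lemma g_pow_mod (i : Fin n) (e : ℕ) : D.g i ^ (e % m i) = D.g i ^ e := by
  rw [← D.orderOf_g i, pow_mod_orderOf]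

lemma m_pos (D : CyclicFactors G m) (i : Fin n) : 0 < m i := (Nat.zero_le _).trans_lt (D.exponent_lt 1 i)

lemma exponent_mul (x y : G) (i : Fin n) :
    D.exponent (x * y) i = (D.exponent x i + D.exponent y i) % m i := by
  refine congrFun (D.exponent_eq (e := fun i => (D.exponent x i + D.exponent y i) % m i)
    (fun i => Nat.mod_lt _ (D.m_pos i)) ?_) i
  simp only [g_pow_mod, pow_add, Finset.prod_mul_distrib, prod_exponent]

lemma exponent_one (i : Fin n) : D.exponent 1 i = 0 :=
  congrFun (D.exponent_eq (e := fun _ => 0) D.m_pos (by simp)) i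

lemma geom_eq (r : Fin n) (e : ℕ) : D.geom r e = ∑ j ∈ Finset.range e, elt (D.g r) ^ j := by
  simp [geom]

lemma geom_add (r : Fin n) (e f : ℕ) :
    D.geom r (e + f) = D.geom r e + elt (D.g r ^ e) * D.geom r f := by
  simp only [geom_eq, Finset.sum_range_add, elt_pow, Finset.mul_sum, pow_add]

lemma T_mul_geom (r : Fin n) (e : ℕ) : D.T r * D.geom r e = elt (D.g r ^ e) - 1 := by
  rw [T, geom_eq, mul_geom_sum, elt_pow]

lemma geom_m (r : Fin n) : D.geom r (m r) = D.N r := rfl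

lemma geom_m_mul (r : Fin n) (q : ℕ) : D.geom r (m r * q) = q * D.N r := by
  induction q with
  | zero => simp [geom]
  | succ q ih =>
    rw [Nat.mul_succ, geom_add, ih, pow_mul, g_pow_m, one_pow, geom_m]
    push_cast
    rw [elt_one]; ring

/-- The carry `[(x_r + y_r) / m_r]` of the exponents of `g_r` in `x` and `y`. -/
def carry (r : Fin n) (x y : G) : GroupRing G :=
  (((D.exponent x r + D.exponent y r) / m r : ℕ) : GroupRing G)

/-- Both ways of adding three exponents compute the integer part of their total divided by `m r`. -/
lemma carry_cocycle (r : Fin n) (x y z : G) :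
    D.carry r y z - D.carry r (x * y) z + D.carry r x (y * z) - D.carry r x y = 0 := by
  have key : (D.exponent y r + D.exponent z r) / m r +
      (D.exponent x r + D.exponent (y * z) r) / m r =
      (D.exponent (x * y) r + D.exponent z r) / m r +
      (D.exponent x r + D.exponent y r) / m r := by
    rw [exponent_mul, exponent_mul]
    generalize D.exponent x r = a, D.exponent y r = b, D.exponent z r = c
    have hm := D.m_pos r
    have h1 : (a + b + c) / m r = ((a + b) % m r + c) / m r + (a + b) / m r := by
      conv_lhs => rw [← Nat.mod_add_div (a + b) (m r), add_right_comm,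
        Nat.add_mul_div_left _ _ hm]
    have h2 : (a + b + c) / m r = (a + (b + c) % m r) / m r + (b + c) / m r := by
      conv_lhs => rw [add_assoc, ← Nat.mod_add_div (b + c) (m r), ← add_assoc,
        Nat.add_mul_div_left _ _ hm]
    omega
  have := congrArg (fun q : ℕ => (q : GroupRing G)) key
  simp only [Nat.cast_add] at this
  simp only [carry]
  linear_combination this

/-- Reducing the sum of the exponents modulo `m r` removes as many full periods from the geometric
sum as the carry counts. Each period contributes `N`, since powers of `g r` fix `N`. -/
lemma geom_exponent_mul (r : Fin n) (x y : G) :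
    D.geom r (D.exponent (x * y) r) + D.N r * D.carry r x y =
      D.geom r (D.exponent x r) + elt (D.g r ^ D.exponent x r) * D.geom r (D.exponent y r) := by
  rw [← geom_add]
  conv_rhs => rw [← Nat.mod_add_div (D.exponent x r + D.exponent y r) (m r)]
  rw [geom_add, ← exponent_mul, geom_m_mul, exponent_mul, g_pow_mod, pow_add]
  have h : ∀ e, elt (D.g r ^ e) * D.N r = D.N r := by
    intro e
    have := D.T_mul_geom r e
    linear_combination (-D.N r) * this + D.geom r e * D.T_mul_N r
  rw [carry, elt_mul]
  linear_combination (-((((D.exponent x r + D.exponent y r) / m r : ℕ) : GroupRing G))) *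
    (elt (D.g r ^ D.exponent x r) * h (D.exponent y r) + h (D.exponent x r))

/-! ### The comparison for one cyclic factor -/

/-- The component at a single cyclic factor, without its twist, of the comparison map. -/
def cochain (r : Fin n) : ℕ → (ℕ → G) → GroupRing G
  | 0, _ => 1
  | 1, w => D.geom r (D.exponent (w 0) r)
  | p + 2, w => cochain r p w * D.carry r (w p) (w (p + 1))

lemma cochain_congr (r : Fin n) (p : ℕ) {w w' : ℕ → G} (h : ∀ i < p, w i = w' i) :
    D.cochain r p w = D.cochain r p w' := by
  induction p using Nat.twoStepInduction with
  | zero => rfl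
  | one => rw [cochain, cochain, h 0 one_pos]
  | more p ih _ =>
    rw [cochain, cochain, ih fun i hi => h i (by omega), h p (by omega), h (p + 1) (by omega)]

/-- The coefficient of `Φ(…, p, …)` in the `i`-th part of the differential of
`Φ(…, p + 1, …)`, up to sign. -/
def step (r : Fin n) (p : ℕ) : GroupRing G := if Even p then D.T r else D.N r

/-- Degree zero is the telescoping of `T` times a geometric sum, degree one is `geom_exponent_mul`.
Two more degrees multiply everything by a carry of the last two entries; the terms that do not match
add up to a multiple of the carry cocycle identity. -/
lemma step_mul_cochain (r : Fin n) (p : ℕ) (w : ℕ → G) :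
    D.step r p * D.cochain r (p + 1) w =
      elt (D.g r ^ D.exponent (w 0) r) * D.cochain r p (fun i => w (i + 1)) +
      ∑ u ∈ Finset.range p, (-1) ^ (u + 1) * D.cochain r p (contractSeq u w) +
      (-1) ^ (p + 1) * D.cochain r p w := by
  induction p using Nat.twoStepInduction with
  | zero => simp [step, cochain, T_mul_geom, sub_eq_add_neg]
  | one =>
    have := D.geom_exponent_mul r (w 0) (w 1)
    simp only [step, cochain, contractSeq_self, Nat.not_even_one, if_false, Finset.sum_range_one]
    simp only [zero_add]
    linear_combination this
  | more p ih _ =>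
    have hs : D.step r (p + 2) = D.step r p := by simp [step, Nat.even_add]
    have hsum : ∀ u ∈ Finset.range p,
        (-1 : GroupRing G) ^ (u + 1) * D.cochain r (p + 2) (contractSeq u w) =
        (-1) ^ (u + 1) * D.cochain r p (contractSeq u w) *
          D.carry r (w (p + 1)) (w (p + 2)) := by
      intro u hu
      have hu := Finset.mem_range.1 hu
      rw [cochain, contractSeq_of_gt _ hu, contractSeq_of_gt _ (by omega), mul_assoc]
    have h1 : D.cochain r (p + 2) (contractSeq p w) =
        D.cochain r p w * D.carry r (w p * w (p + 1)) (w (p + 2)) := by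
      rw [cochain, contractSeq_self, contractSeq_of_gt _ (by omega),
        D.cochain_congr r p fun i hi => contractSeq_of_lt w hi]
    have h2 : D.cochain r (p + 2) (contractSeq (p + 1) w) =
        D.cochain r p w * D.carry r (w p) (w (p + 1) * w (p + 2)) := by
      rw [cochain, contractSeq_self, contractSeq_of_lt _ (by omega),
        D.cochain_congr r p fun i hi => contractSeq_of_lt w (by omega)]
    rw [hs, Finset.sum_range_succ, Finset.sum_range_succ, Finset.sum_congr rfl hsum,
      ← Finset.sum_mul, h1, h2]
    rw [show D.cochain r (p + 2 + 1) w =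
      D.cochain r (p + 1) w * D.carry r (w (p + 1)) (w (p + 2)) from rfl]
    rw [show D.cochain r (p + 2) w = D.cochain r p w * D.carry r (w p) (w (p + 1)) from rfl]
    rw [show D.cochain r (p + 2) (fun i => w (i + 1)) =
      D.cochain r p (fun i => w (i + 1)) * D.carry r (w (p + 1)) (w (p + 2)) from rfl]
    linear_combination D.carry r (w (p + 1)) (w (p + 2)) * ih -
      (-1) ^ p * D.cochain r p w * D.carry_cocycle r (w p) (w (p + 1)) (w (p + 2))

/-! ### Twisting by projections, and the coefficients -/

/-- The part `∏_{s<j} g_s^{x_s}` of `x = ∏_s g_s^{x_s}`, with `s` counted from `0`. -/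
def prefixHom (j : ℕ) : G →* G where
  toFun x := ∏ s with s.val < j, D.g s ^ D.exponent x s
  map_one' := by simp [exponent_one]
  -- Exponents add only modulo `m s`, which is harmless because `g s` has order `m s`.
  map_mul' x y := by simp [exponent_mul, g_pow_mod, pow_add, Finset.prod_mul_distrib]

lemma prefixHom_zero (x : G) : D.prefixHom 0 x = 1 := by simp [prefixHom]

lemma prefixHom_top (x : G) : D.prefixHom n x = x := by
  simpa [prefixHom] using D.prod_exponent x

lemma prefixHom_val (r : Fin n) (x : G) :
    D.prefixHom r x = ∏ s ∈ Finset.Iio r, D.g s ^ D.exponent x s := by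
  change ∏ s : Fin n with s.val < r.val, D.g s ^ D.exponent x s = _
  exact Finset.prod_congr (by ext; simp) fun _ _ => rfl

lemma prefixHom_succ (r : Fin n) (x : G) :
    D.prefixHom (r + 1) x = D.prefixHom r x * D.g r ^ D.exponent x r := by
  have : Finset.univ.filter (fun s : Fin n => s.val < r.val + 1) = insert r (Finset.Iio r) := by
    ext s; simp
  rw [prefixHom_val, mul_comm]
  change ∏ s : Fin n with s.val < r.val + 1, D.g s ^ D.exponent x s = _
  rw [this, Finset.prod_insert (by simp)]

/-- The component at a single cyclic factor, with its twist, of the comparison map. -/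
def twisted (r : Fin n) (p : ℕ) (w : ℕ → G) : GroupRing G :=
  D.cochain r p w * elt (D.prefixHom r (∏ i ∈ Finset.range p, w i))

lemma twisted_congr (r : Fin n) (p : ℕ) (w w' : ℕ → G) (h : ∀ i < p, w i = w' i) :
    D.twisted r p w = D.twisted r p w' := by
  rw [twisted, twisted, D.cochain_congr r p h,
    Finset.prod_congr rfl fun i hi => h i (Finset.mem_range.1 hi)]

lemma prod_contractSeq {p u : ℕ} (hu : u < p) (w : ℕ → G) :
    ∏ i ∈ Finset.range p, contractSeq u w i = ∏ i ∈ Finset.range (p + 1), w i := by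
  induction p with
  | zero => omega
  | succ p ih =>
    rw [Finset.prod_range_succ]
    rcases Nat.lt_succ_iff_lt_or_eq.1 hu with h | rfl
    · rw [ih h, contractSeq_of_gt _ h, Finset.prod_range_succ _ (p + 1)]
    · rw [contractSeq_self, Finset.prod_range_succ _ (u + 1), Finset.prod_range_succ, mul_assoc,
        Finset.prod_congr rfl fun i hi => contractSeq_of_lt w (Finset.mem_range.1 hi)]

/-- A contraction preserves the total product, so all inner terms carry the same twist. Deleting the
first entry frees its `M_r`, which merges with the power of `g r` to `M_{r+1}`; deleting the last
entry frees `M_r` alone. -/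
lemma step_mul_twisted (r : Fin n) (p : ℕ) (w : ℕ → G) :
    D.step r p * D.twisted r (p + 1) w =
      elt (D.prefixHom (r + 1) (w 0)) * D.twisted r p (fun i => w (i + 1)) +
      ∑ u ∈ Finset.range p, (-1) ^ (u + 1) * D.twisted r p (contractSeq u w) +
      (-1) ^ (p + 1) * (D.twisted r p w * elt (D.prefixHom r (w p))) := by
  have hsum : ∀ u ∈ Finset.range p,
      (-1 : GroupRing G) ^ (u + 1) * D.twisted r p (contractSeq u w) =
      (-1) ^ (u + 1) * D.cochain r p (contractSeq u w) *
        elt (D.prefixHom r (∏ i ∈ Finset.range (p + 1), w i)) := by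
    intro u hu
    rw [twisted, prod_contractSeq (Finset.mem_range.1 hu), mul_assoc]
  have h0 : elt (D.prefixHom r (∏ i ∈ Finset.range (p + 1), w i)) =
      elt (D.prefixHom r (∏ i ∈ Finset.range p, w (i + 1))) * elt (D.prefixHom r (w 0)) := by
    rw [Finset.prod_range_succ', map_mul, elt_mul]
  have h1 : elt (D.prefixHom r (∏ i ∈ Finset.range (p + 1), w i)) =
      elt (D.prefixHom r (∏ i ∈ Finset.range p, w i)) * elt (D.prefixHom r (w p)) := by
    rw [Finset.prod_range_succ, map_mul, elt_mul]
  rw [Finset.sum_congr rfl hsum, ← Finset.sum_mul, twisted, ← mul_assoc, step_mul_cochain,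
    prefixHom_succ, elt_mul, add_mul, add_mul]
  congr 1
  · congr 1
    rw [h0, twisted]; ring
  · rw [h1, twisted]; ring

/-- The coefficient of `Φ(a)`, up to sign, in the value of the comparison map on `w`. -/
def coeff (a : Fin n → ℕ) (w : ℕ → G) : GroupRing G := segmentProd D.twisted a w

lemma sum_step_mul_coeff (a : Fin n → ℕ) (w : ℕ → G) :
    ∑ i, (-1) ^ (∑ s ∈ Finset.Ioi i, a s) * (D.step i (a i) *
        D.coeff (Function.update a i (a i + 1)) w) =
      elt (w 0) * D.coeff a (fun i => w (i + 1)) +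
      ∑ u ∈ Finset.range (∑ i, a i), (-1) ^ (u + 1) * D.coeff a (contractSeq u w) +
      (-1) ^ (∑ i, a i + 1) * D.coeff a w := by
  have := segmentProd_coboundary (fun j x => elt (D.prefixHom j x)) D.twisted D.step
    (fun x => by rw [prefixHom_zero, elt_one]) D.twisted_congr D.step_mul_twisted a w
  rw [prefixHom_top] at this
  exact this

end Cochains

/-! ### Matching the explicit formula: compositions and exponent vectors -/

noncomputable section Comparison

variable {G : Type u} [CommGroup G] {n : ℕ} {m : Fin n → ℕ} (D : CyclicFactors G m)

/-- A tuple, extended to a sequence by `1`. -/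
def extend {k : ℕ} (h : Fin k → G) (i : ℕ) : G := if H : i < k then h ⟨i, H⟩ else 1

lemma extend_val {k : ℕ} (h : Fin k → G) (i : Fin k) : extend h i = h i := by simp [extend]

/-- The default values agree: padding by `1` gives exponent `0`, the value of `alpha` outside its
range. The index shifts from one-based to zero-based. -/
lemma alpha_succ {k : ℕ} (h : Fin k → G) (i : ℕ) (r : Fin n) :
    D.alpha h (i + 1) r = D.exponent (extend h i) r := by
  by_cases H : i < k
  · rw [alpha, dif_pos (by omega), extend, dif_pos H]; rfl
  · rw [alpha, dif_neg (by omega), extend, dif_neg H, exponent_one]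

lemma cochain_two_mul_add (r : Fin n) (q e : ℕ) (w : ℕ → G) :
    D.cochain r (2 * q + e) w = D.cochain r e w *
      ∏ j ∈ Finset.range q,
        D.carry r (w (2 * q + e - 2 * j - 2)) (w (2 * q + e - 2 * j - 1)) := by
  induction q with
  | zero => simp
  | succ q ih =>
    rw [show 2 * (q + 1) + e = 2 * q + e + 2 by ring, cochain, ih, Finset.prod_range_succ',
      ← mul_assoc]
    congr 1
    congr 1
    refine Finset.prod_congr rfl fun j _ => ?_
    congr 2 <;> omega

lemma elt_prefix_eq (r : Fin n) (p A : ℕ) (w : ℕ → G) (α : ℕ → Fin n → ℕ)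
    (hα : ∀ i s, α (i + 1) s = D.exponent (w i) s) :
    ∏ s ∈ Finset.Iio r, D.g s ^ (∑ c ∈ Finset.Icc (A + 1) (A + p), α c s) =
      D.prefixHom r (∏ i ∈ Finset.range p, w (i + A)) := by
  simp only [map_prod, prefixHom_val]
  rw [Finset.prod_comm]
  refine Finset.prod_congr rfl fun s _ => ?_
  rw [Finset.prod_pow_eq_pow_sum, ← Finset.Ico_add_one_right_eq_Icc,
    Finset.sum_Ico_eq_sum_range, show A + p + 1 - (A + 1) = p by omega]
  congr 1
  refine Finset.sum_congr rfl fun i _ => ?_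
  rw [← hα]
  congr 1
  omega

/-- A segment of length `p` at offset `A` is the interval `[A + 1, A + p]`, so `b - a = p - 1` has
the parity opposite to `p`: the geometric factor occurs exactly for odd `p`. -/
lemma xi_eq_twisted (r : Fin n) (p A : ℕ) (hp : 1 ≤ p) (w : ℕ → G) (α : ℕ → Fin n → ℕ)
    (hα : ∀ i s, α (i + 1) s = D.exponent (w i) s) :
    D.xi α r (A + 1) (A + p) = D.twisted r p fun i => w (i + A) := by
  have hprod : ∀ q, 2 * q ≤ p → ∏ j ∈ Finset.range q,
      (((α (A + p - 2 * j) r + α (A + p - 2 * j - 1) r) / m r : ℕ) : GroupRing G) =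
      ∏ j ∈ Finset.range q, D.carry r (w (p - 2 * j - 2 + A)) (w (p - 2 * j - 1 + A)) := by
    intro q hq
    refine Finset.prod_congr rfl fun j hj => ?_
    have hj := Finset.mem_range.1 hj
    rw [carry, ← hα, ← hα, add_comm (α _ r)]
    congr 4 <;> omega
  rw [xi, twisted, D.elt_prefix_eq r p A w α hα, show A + p - (A + 1) = p - 1 by omega]
  obtain ⟨q, rfl | rfl⟩ := Nat.even_or_odd' p
  · rw [if_pos (by rw [Nat.odd_iff]; omega), hprod _ (by omega),
      show (2 * q - 1 + 1) / 2 = q by omega]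
    have := D.cochain_two_mul_add r q 0 fun i => w (i + A)
    simp only [add_zero] at this
    rw [this, cochain, one_mul]
  · rw [if_neg (by rw [Nat.odd_iff]; omega), hprod _ (by omega),
      show (2 * q + 1 - 1) / 2 = q by omega, cochain_two_mul_add, cochain, hα A r]
    simp only [zero_add]
    ring

lemma upper_eq {k : ℕ} (c : Composition k) (u : Fin c.length) :
    upper c u = ∑ i ∈ Finset.Ioi u, c.blocksFun i + c.blocksFun u := by
  rw [upper, ← Finset.Ioi_insert, Finset.sum_insert (by simp), add_comm]

lemma expVec_apply {k : ℕ} (c : Composition k) (r : Fin c.length ↪o Fin n) (u : Fin c.length) :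
    expVec c r (r u) = c.blocksFun u := by
  rw [expVec, Finset.sum_apply, Finset.sum_eq_single u]
  · simp
  · intro v _ hv
    rw [Pi.single_eq_of_ne]
    exact fun h => hv (r.injective h).symm
  · simp

lemma expVec_eq_zero {k : ℕ} (c : Composition k) (r : Fin c.length ↪o Fin n) {s : Fin n}
    (hs : s ∉ Set.range r) : expVec c r s = 0 := by
  rw [expVec, Finset.sum_apply]
  refine Finset.sum_eq_zero fun u _ => ?_
  rw [Pi.single_eq_of_ne]
  rintro rfl
  exact hs ⟨u, rfl⟩

/-- Indices outside the support add nothing, so the offset of a segment is the same whether counted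
over blocks or over all factors. -/
lemma sum_Ioi_expVec {k : ℕ} (c : Composition k) (r : Fin c.length ↪o Fin n)
    (u : Fin c.length) :
    ∑ s ∈ Finset.Ioi (r u), expVec c r s = ∑ i ∈ Finset.Ioi u, c.blocksFun i := by
  symm
  refine Finset.sum_of_injOn r r.injective.injOn ?_ ?_ ?_
  · intro i hi; simpa using hi
  · intro s hs hs'
    refine expVec_eq_zero c r ?_
    rintro ⟨v, rfl⟩
    exact hs' ⟨v, by simpa using hs, rfl⟩
  · intro i _; rw [expVec_apply]

/-- The sign `(-1)^{∑_{i<j} a_i a_j}`. -/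
def vecSign (a : Fin n → ℕ) : ℤ := (-1) ^ ∑ i, ∑ j ∈ Finset.Ioi i, a i * a j

lemma compSign_eq {k : ℕ} (c : Composition k) (r : Fin c.length ↪o Fin n) :
    compSign c = vecSign (expVec c r) := by
  rw [compSign, vecSign]
  congr 1
  refine Fintype.sum_of_injective r r.injective _ _ ?_ ?_
  · intro s hs; simp [expVec_eq_zero c r hs]
  · intro u; rw [← Finset.mul_sum, ← Finset.mul_sum, sum_Ioi_expVec, expVec_apply]

lemma twisted_zero (r : Fin n) (w : ℕ → G) : D.twisted r 0 w = 1 := by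
  rw [twisted, cochain, Finset.prod_range_zero, map_one, elt_one, one_mul]

/-- Factors outside the range of `r` have empty segments and contribute `1`. -/
lemma prod_xi_eq {k : ℕ} (h : Fin k → G) (c : Composition k) (r : Fin c.length ↪o Fin n) :
    ∏ u, D.xi (D.alpha h) (r u) (lower c u) (upper c u) =
      D.coeff (expVec c r) (extend h) := by
  refine Fintype.prod_of_injective r r.injective _ _ ?_ ?_
  · intro s hs; rw [expVec_eq_zero c r hs, twisted_zero]
  · intro u
    rw [lower, upper_eq, D.xi_eq_twisted (r u) _ _ (c.one_le_blocksFun u) (extend h) _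
      (D.alpha_succ h), sum_Ioi_expVec, expVec_apply]

/-- The support of an exponent vector. -/
def supp (a : Fin n → ℕ) : Finset (Fin n) := {s | a s ≠ 0}

lemma range_eq_supp {k : ℕ} (c : Composition k) (r : Fin c.length ↪o Fin n) (s : Fin n) :
    s ∈ Set.range r ↔ s ∈ supp (expVec c r) := by
  simp only [supp, Finset.mem_filter, Finset.mem_univ, true_and]
  constructor
  · rintro ⟨u, rfl⟩
    rw [expVec_apply]
    exact Nat.one_le_iff_ne_zero.1 (c.one_le_blocksFun u)
  · intro h
    by_contra h'
    exact h (expVec_eq_zero c r h')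

lemma card_supp {k : ℕ} (c : Composition k) (r : Fin c.length ↪o Fin n) :
    (supp (expVec c r)).card = c.length := by
  have : supp (expVec c r) = Finset.univ.map r.toEmbedding := by
    ext s; rw [← range_eq_supp]; simp
  rw [this, Finset.card_map, Finset.card_univ, Fintype.card_fin]

/-- A finite set has only one increasing enumeration, so the exponent vector determines `r`. -/
lemma eq_orderEmbOfFin {k : ℕ} (c : Composition k) (r : Fin c.length ↪o Fin n) :
    r = (supp (expVec c r)).orderEmbOfFin (card_supp c r) :=
  Finset.orderEmbOfFin_unique' _ fun u => (range_eq_supp c r _).1 ⟨u, rfl⟩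

lemma blocks_eq {k : ℕ} (c : Composition k) (r : Fin c.length ↪o Fin n) :
    c.blocks = List.ofFn fun i =>
      expVec c r ((supp (expVec c r)).orderEmbOfFin rfl i) := by
  -- The number of blocks and the size of the support are equal but not definitionally; generalizing
  -- the former lets the equality be substituted.
  have key : ∀ (S : Finset (Fin n)) (hS : S.card = c.length) (f : Fin n → ℕ),
      List.ofFn (fun u => f (S.orderEmbOfFin hS u)) =
      List.ofFn fun i => f (S.orderEmbOfFin rfl i) := by
    intro S hS f
    generalize c.length = l at hS
    subst hS
    rfl
  rw [← key _ (card_supp c r), ← eq_orderEmbOfFin, ← c.ofFn_blocksFun]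
  congr 1
  funext u
  rw [expVec_apply]

lemma expVec_injective {k : ℕ} {c c' : Composition k} {r : Fin c.length ↪o Fin n}
    {r' : Fin c'.length ↪o Fin n} (h : expVec c r = expVec c' r') :
    (⟨c, r⟩ : Σ c : Composition k, Fin c.length ↪o Fin n) = ⟨c', r'⟩ := by
  obtain rfl : c = c' := by
    refine Composition.ext ?_
    rw [blocks_eq c r, blocks_eq c' r', h]
  congr 1
  rw [eq_orderEmbOfFin c r, eq_orderEmbOfFin c r']
  congr 1
  rw [h]

lemma expVec_surjective {k : ℕ} (a : Fin n → ℕ) (ha : ∑ i, a i = k) :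
    ∃ (c : Composition k) (r : Fin c.length ↪o Fin n), expVec c r = a := by
  set o := (supp a).orderEmbOfFin rfl with ho
  have hmem : ∀ s, s ∈ Set.range o ↔ a s ≠ 0 := by
    intro s; rw [ho, Finset.range_orderEmbOfFin]; simp [supp]
  let c : Composition k :=
    { blocks := List.ofFn fun i => a (o i)
      blocks_pos := by
        intro i hi
        obtain ⟨j, rfl⟩ := (List.mem_ofFn' _ _).1 hi
        exact Nat.pos_of_ne_zero ((hmem _).1 ⟨j, rfl⟩)
      blocks_sum := by
        rw [List.sum_ofFn, ← ha]
        refine Fintype.sum_of_injective o o.injective _ _ ?_ fun _ => rfl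
        intro s hs
        by_contra h
        exact hs ((hmem s).2 h) }
  have hl : c.length = (supp a).card := List.length_ofFn
  let r : Fin c.length ↪o Fin n := (Fin.castOrderIso hl).toOrderEmbedding.trans o
  have hb : ∀ u, c.blocksFun u = a (r u) := by
    intro u
    simp only [Composition.blocksFun, c, r, List.get_ofFn]
    rfl
  refine ⟨c, r, funext fun s => ?_⟩
  by_cases hs : s ∈ Set.range r
  · obtain ⟨u, rfl⟩ := hs
    rw [expVec_apply, hb]
  · rw [expVec_eq_zero c r hs]
    by_contra h
    obtain ⟨j, rfl⟩ := (hmem s).2 (Ne.symm h)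
    exact hs ⟨Fin.cast hl.symm j, rfl⟩

/-- The value of `F_k` as a sum over exponent vectors. -/
lemma FValue_eq {k : ℕ} (h : Fin k → G) :
    D.FValue h = ∑ a ∈ Finset.piAntidiag (Finset.univ : Finset (Fin n)) k,
      vecSign a • D.coeff a (extend h) • D.Phi k a := by
  rw [FValue, Finset.sum_sigma']
  refine Finset.sum_bij (fun x _ => expVec x.1 x.2) ?_ ?_ ?_ ?_
  · intro x _; simp [sum_expVec]
  · rintro ⟨c, r⟩ _ ⟨c', r'⟩ _ h; exact expVec_injective h
  · intro a ha
    obtain ⟨c, r, rfl⟩ := expVec_surjective a (by simpa using ha)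
    exact ⟨⟨c, r⟩, by simp, rfl⟩
  · rintro ⟨c, r⟩ _
    rw [compSign_eq c r, prod_xi_eq]

/-- An entry `1` has exponent `0`: it gives an empty geometric sum, or a carry whose other summand
is below `m r`. -/
lemma cochain_eq_zero (r : Fin n) (p : ℕ) (w : ℕ → G) {i : ℕ} (hi : i < p) (hw : w i = 1) :
    D.cochain r p w = 0 := by
  induction p using Nat.twoStepInduction with
  | zero => omega
  | one =>
    obtain rfl : i = 0 := by omega
    simp [cochain, hw, exponent_one, geom]
  | more p ih _ =>
    rw [cochain]
    by_cases h : i < p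
    · rw [ih h, zero_mul]
    · have : D.carry r (w p) (w (p + 1)) = 0 := by
        rw [carry, Nat.div_eq_of_lt, Nat.cast_zero]
        rcases (by omega : i = p ∨ i = p + 1) with rfl | rfl
        · rw [hw, exponent_one, zero_add]; exact D.exponent_lt _ r
        · rw [hw, exponent_one, add_zero]; exact D.exponent_lt _ r
      rw [this, mul_zero]

end Comparison

/-! ### Normalization, signs and the chain map -/

noncomputable section ChainMap

variable {G : Type u} [CommGroup G] {n : ℕ} {m : Fin n → ℕ} (D : CyclicFactors G m)

lemma coeff_congr (a : Fin n → ℕ) {w w' : ℕ → G} (h : ∀ i < ∑ s, a s, w i = w' i) :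
    D.coeff a w = D.coeff a w' := segmentProd_congr D.twisted_congr a h

lemma coeff_eq_zero (a : Fin n → ℕ) {w : ℕ → G} {i : ℕ} (hi : i < ∑ s, a s) (hw : w i = 1) :
    D.coeff a w = 0 :=
  segmentProd_eq_zero (fun r p w i hi hw => by
    rw [twisted, D.cochain_eq_zero r p w hi hw, zero_mul]) a hi hw

/-- The formula for `F_k` vanishes on tuples with an entry `1`. -/
lemma FValue_eq_zero {k : ℕ} {h : Fin k → G} (i : Fin k) (hi : h i = 1) : D.FValue h = 0 := by
  rw [FValue_eq]
  refine Finset.sum_eq_zero fun a ha => ?_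
  have ha : ∑ s, a s = k := by simpa using ha
  rw [D.coeff_eq_zero a (i := i) (by rw [ha]; exact i.2) (by rw [extend_val, hi]), zero_smul,
    smul_zero]

lemma F_sym {k : ℕ} (h : Fin k → G) : D.F k (sym h) = D.FValue h := by
  by_cases H : ∀ i, h i ≠ 1
  · rw [sym, dif_pos H]; simp [F]
  · push Not at H
    obtain ⟨i, hi⟩ := H
    rw [sym_eq_zero i hi, map_zero, D.FValue_eq_zero i hi]

lemma extend_tail {k : ℕ} (h : Fin (k + 1) → G) :
    extend (Fin.tail h) = fun i => extend h (i + 1) := by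
  funext i
  by_cases hi : i < k
  · rw [extend, dif_pos hi, extend, dif_pos (by omega)]; rfl
  · rw [extend, dif_neg hi, extend, dif_neg (by omega)]

/-- The bound `i < k` is needed: for `j = k`, `Fin.contractNth` drops the last entry while
`contractSeq` keeps it at position `k`. -/
lemma extend_contractNth {k : ℕ} (h : Fin (k + 1) → G) (j : Fin (k + 1)) (i : ℕ) (hi : i < k) :
    extend (Fin.contractNth j (· * ·) h) i = contractSeq j (extend h) i := by
  rw [extend, dif_pos hi]
  have e0 : extend h i = h ⟨i, by omega⟩ := by rw [extend, dif_pos]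
  have e1 : extend h (i + 1) = h ⟨i + 1, by omega⟩ := by rw [extend, dif_pos]
  rcases lt_trichotomy i j with h' | h' | h'
  · rw [contractSeq_of_lt _ h', e0]
    simp [Fin.contractNth, h']
  · rw [← h', contractSeq_self, e0, e1]
    simp [Fin.contractNth, h']
  · rw [contractSeq_of_gt _ h', e1]
    simp [Fin.contractNth, h'.ne', h'.not_gt]

lemma F_bdry {k : ℕ} (h : Fin (k + 1) → G) :
    D.F k (bdry h) = ∑ a ∈ Finset.piAntidiag (Finset.univ : Finset (Fin n)) k,
      vecSign a • (elt (h 0) * D.coeff a (fun i => extend h (i + 1)) +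
        ∑ u ∈ Finset.range k, (-1) ^ (u + 1) * D.coeff a (contractSeq u (extend h)) +
        (-1) ^ (k + 1) * D.coeff a (extend h)) • D.Phi k a := by
  rw [bdry, map_add, map_smul, map_sum, F_sym, FValue_eq, extend_tail, Finset.smul_sum]
  simp only [map_zsmul, F_sym, FValue_eq, Finset.smul_sum]
  rw [Finset.sum_comm, ← Finset.sum_add_distrib]
  refine Finset.sum_congr rfl fun a ha => ?_
  have ha : ∑ s, a s = k := by simpa using ha
  have h1 : ∀ j : Fin (k + 1), D.coeff a (extend (Fin.contractNth j (· * ·) h)) =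
      D.coeff a (contractSeq j (extend h)) := fun j =>
    D.coeff_congr a fun i hi => extend_contractNth h j i (ha ▸ hi)
  -- The contraction at `k` changes nothing among the first `k` entries, so it yields the last face
  -- of the bar boundary.
  have h2 : D.coeff a (contractSeq k (extend h)) = D.coeff a (extend h) :=
    D.coeff_congr a fun i hi => contractSeq_of_lt _ (ha ▸ hi)
  simp only [h1]
  rw [Fin.sum_univ_eq_sum_range (fun j => (-1 : ℤ) ^ (j + 1) • vecSign a •
    D.coeff a (contractSeq j (extend h)) • D.Phi k a), Finset.sum_range_succ, h2, add_assoc,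
    add_smul, smul_add, add_smul, smul_add, Finset.sum_smul, Finset.smul_sum]
  have hz : ∀ (e : ℕ) (c : GroupRing G), (-1 : ℤ) ^ e • vecSign a • c • D.Phi k a =
      vecSign a • ((-1) ^ e * c) • D.Phi k a := by
    intro e c
    rw [smul_comm, ← smul_assoc (_ : ℤ) c, zsmul_eq_mul]
    push_cast
    rfl
  simp only [hz]
  rw [smul_comm (elt (h 0)), smul_smul (elt (h 0))]

/-- Raising `a i` by one increases the sum of the products `a s * a t` over `s < t` by the sum of
all other entries, those below `i` and those above. -/
lemma vecSign_update (a : Fin n → ℕ) (i : Fin n) :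
    vecSign (Function.update a i (a i + 1)) * (-1) ^ ∑ l ∈ Finset.Iio i, a l =
      vecSign a * (-1) ^ ∑ s ∈ Finset.Ioi i, a s := by
  have hu : ∀ s, Function.update a i (a i + 1) s = a s + if s = i then 1 else 0 := by
    intro s
    by_cases h : s = i
    · subst h; simp
    · simp [h]
  have key : ∑ s, ∑ t ∈ Finset.Ioi s,
      Function.update a i (a i + 1) s * Function.update a i (a i + 1) t =
      ∑ s, ∑ t ∈ Finset.Ioi s, a s * a t + ∑ s ∈ Finset.Ioi i, a s +
        ∑ l ∈ Finset.Iio i, a l := by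
    simp only [hu, add_mul, mul_add, Finset.sum_add_distrib]
    have h1 : ∑ s, ∑ t ∈ Finset.Ioi s, a s * (if t = i then 1 else 0) =
        ∑ l ∈ Finset.Iio i, a l := by
      simp only [mul_ite, mul_one, mul_zero, Finset.sum_ite_eq', Finset.mem_Ioi]
      rw [← Finset.sum_filter]
      exact Finset.sum_congr (by ext; simp) fun _ _ => rfl
    have h2 : ∑ s, ∑ t ∈ Finset.Ioi s, (if s = i then 1 else 0) * a t =
        ∑ s ∈ Finset.Ioi i, a s := by
      simp
    have h3 : ∑ s, ∑ t ∈ Finset.Ioi s,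
        (if s = i then 1 else 0) * (if t = i then 1 else 0) = 0 := by
      refine Finset.sum_eq_zero fun s _ => Finset.sum_eq_zero fun t ht => ?_
      have := Finset.mem_Ioi.1 ht
      split_ifs <;> grind
    rw [h1, h2, h3]
    ring
  rw [vecSign, vecSign, key, pow_add, pow_add, mul_assoc, ← mul_pow]
  simp

lemma koszulPart_update (k : ℕ) (i : Fin n) (a : Fin n → ℕ) :
    D.koszulPart k i (Function.update a i (a i + 1)) =
      ((-1 : ℤ) ^ ∑ l ∈ Finset.Iio i, a l) • D.step i (a i) • D.Phi k a := by
  have hs : ∑ l ∈ Finset.Iio i, Function.update a i (a i + 1) l = ∑ l ∈ Finset.Iio i, a l := by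
    refine Finset.sum_congr rfl fun l hl => ?_
    rw [Function.update_of_ne (Finset.mem_Iio.1 hl).ne]
  rw [koszulPart, if_neg (by simp), hs, Function.update_self, Nat.add_sub_cancel,
    Function.update_idem, Function.update_eq_self]
  simp only [step, Nat.even_add_one, ite_not]

/-- Reindexes by raising the `i`-th entry; vectors with `i`-th entry zero are missed, but there the
`i`-th part of the differential vanishes. -/
lemma sum_koszulPart (k : ℕ) (i : Fin n) (f : (Fin n → ℕ) → GroupRing G) :
    ∑ b ∈ Finset.piAntidiag (Finset.univ : Finset (Fin n)) (k + 1), f b • D.koszulPart k i b =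
      ∑ a ∈ Finset.piAntidiag (Finset.univ : Finset (Fin n)) k,
        f (Function.update a i (a i + 1)) •
          D.koszulPart k i (Function.update a i (a i + 1)) := by
  symm
  refine Finset.sum_of_injOn (fun a => Function.update a i (a i + 1)) ?_ ?_ ?_ fun _ _ => rfl
  · intro a _ b _ h
    funext s
    have := congrFun h s
    by_cases hs : s = i
    · subst hs; simpa using this
    · simpa [hs] using this
  · intro a ha
    have := sum_update_pred (Function.update a i (a i + 1)) i (by simp)
    simp only [Function.update_self, Nat.add_sub_cancel, Function.update_idem,
      Function.update_eq_self] at this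
    simpa [← this] using ha
  · intro b hb hb'
    by_cases h : b i = 0
    · rw [koszulPart, if_pos h, smul_zero]
    · refine absurd ⟨Function.update b i (b i - 1), ?_, ?_⟩ hb'
      · have := sum_update_pred b i h
        have hb : ∑ s, b s = k + 1 := by simpa using hb
        have : ∑ s, Function.update b i (b i - 1) s = k := by omega
        simpa using this
      · simp [Nat.sub_add_cancel (Nat.pos_of_ne_zero h)]

lemma koszulD_FValue {k : ℕ} (h : Fin (k + 1) → G) :
    D.koszulD k (D.FValue h) = ∑ a ∈ Finset.piAntidiag (Finset.univ : Finset (Fin n)) k,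
      vecSign a • (∑ i, (-1) ^ (∑ s ∈ Finset.Ioi i, a s) * (D.step i (a i) *
        D.coeff (Function.update a i (a i + 1)) (extend h))) • D.Phi k a := by
  have hz : ∀ (e : ℤ) (c : GroupRing G) (x : D.Koszul k), e • c • x = ((e : GroupRing G) * c) • x :=
    fun e c x => by rw [← smul_assoc, zsmul_eq_mul]
  rw [FValue_eq]
  simp only [map_sum, map_zsmul, map_smul, koszulD_Phi, Finset.smul_sum, Finset.sum_smul, hz]
  rw [Finset.sum_comm, Finset.sum_comm (s := Finset.piAntidiag _ _)]
  refine Finset.sum_congr rfl fun i _ => ?_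
  rw [D.sum_koszulPart k i fun b => (vecSign b : GroupRing G) * D.coeff b (extend h)]
  refine Finset.sum_congr rfl fun a _ => ?_
  rw [koszulPart_update, hz, smul_smul]
  congr 1
  have := congrArg (fun z : ℤ => (z : GroupRing G)) (vecSign_update a i)
  push_cast at this ⊢
  linear_combination D.step i (a i) * D.coeff (Function.update a i (a i + 1)) (extend h) * this

lemma F_bdry_eq {k : ℕ} (h : Fin (k + 1) → G) :
    D.F k (bdry h) = D.koszulD k (D.FValue h) := by
  rw [F_bdry, koszulD_FValue]
  refine Finset.sum_congr rfl fun a ha => ?_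
  have ha : ∑ s, a s = k := by simpa using ha
  rw [sum_step_mul_coeff, ha]
  congr 4

lemma F_comp_barD (k : ℕ) : D.F k ∘ₗ barD G k = D.koszulD k ∘ₗ D.F (k + 1) := by
  refine Finsupp.lhom_ext' fun h => LinearMap.ext_ring ?_
  simp only [LinearMap.comp_apply, Finsupp.lsingle_apply]
  rw [← sym_of_ne, barD_sym, F_bdry_eq, F_sym]

lemma F_zero_sym (h : Fin 0 → G) : D.F 0 (sym h) = D.Phi 0 0 := by
  rw [F_sym, FValue_eq, Finset.piAntidiag_zero, Finset.sum_singleton]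
  simp [vecSign, coeff, segmentProd, twisted_zero]

lemma koszulEps_comp_F : D.koszulEps.comp (D.F 0) = barEps G := by
  refine LinearMap.ext fun x => ?_
  -- In degree zero the bar module is free of rank one on the empty symbol.
  have hx : x = x Fin.elim0 • sym (Fin.elim0 : Fin 0 → G) := by
    have : sym (Fin.elim0 : Fin 0 → G) = Finsupp.single Fin.elim0 1 := by
      rw [← sym_of_ne]; congr 1; exact Subsingleton.elim _ _
    rw [this]
    refine Finsupp.ext fun h => ?_
    rw [Subsingleton.elim h Fin.elim0]
    simp
  have hP : D.koszulEps (D.Phi 0 0) = 1 := by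
    have : D.Phi 0 0 = Finsupp.single ⟨fun _ => 0, by simp⟩ 1 := D.Phi_of_sum ⟨fun _ => 0, by simp⟩
    simp [this, koszulEps]
  rw [LinearMap.comp_apply]
  conv_lhs => rw [hx, map_smul, F_zero_sym, LinearMap.map_smulₛₗ, hP]
  simp [barEps]

/-- The maps `F_k`, as a chain map. -/
def chainMap : barComplex G ⟶ D.koszulComplex :=
  ChainComplex.ofHom (fun k => ModuleCat.ofHom (D.F k)) fun k => by
    simp only [barComplex, koszulComplex, ChainComplex.of_d]
    rw [← ModuleCat.ofHom_comp, ← ModuleCat.ofHom_comp, F_comp_barD]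

end ChainMap
end BarKoszul.CyclicFactors

theorem mainTheorem2 {G : Type u} [CommGroup G] {n : ℕ} {m : Fin n → ℕ}
    (D : BarKoszul.CyclicFactors G m) :
    -- the formula for `F_k` holds on all symbols, including those with an entry `1`, which vanish
    (∀ (k : ℕ) (h : Fin k → G), D.F k (BarKoszul.sym h) = D.FValue h) ∧
    -- the squares formed with the differentials commute
    (∀ k : ℕ, D.F k ∘ₗ BarKoszul.barD G k = D.koszulD k ∘ₗ D.F (k + 1)) ∧
    -- in degree `0` the map is the identity of `ℤG`, and the square with the augmentations commutes
    D.F 0 (BarKoszul.sym Fin.elim0) = D.Phi 0 0 ∧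
    D.koszulEps.comp (D.F 0) = BarKoszul.barEps G ∧
    -- so the `F_k` are the components of a chain map
    (∃ φ : BarKoszul.barComplex G ⟶ D.koszulComplex,
      ∀ k : ℕ, φ.f k = ModuleCat.ofHom (D.F k)) := by
  exact ⟨fun _ h => D.F_sym h, D.F_comp_barD, D.F_zero_sym _, D.koszulEps_comp_F,
    D.chainMap, fun _ => rfl⟩
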